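/- Let $a,b,c\in\mathbb R$ and $\sigma>0$, and suppose that \[ 1-a-b-c>0,\qquad 1-a+b+c>0,\qquad 1+a-b+c>0,\qquad 1+a+b-c>0 . \] Let $\epsilon=\{\epsilon_{i,j}\}_{i,j\in\mathbb Z}$ be pairwise uncorrelated real random variables with $\mathsf E\,\epsilon_{i,j}=0$ and $\mathsf E\,\epsilon_{i,j}^2=\sigma^2$, and let $X=\{X_{i,j}\}_{i,j\in\mathbb Z}$ be a real wide-sense stationary random field (finite second moments, constant mean, translation-invariant covariances) on the same probability space such that, almost surely for all $i,j\in\mathbb Z$, \[ X_{i,j}=aX_{i-1,j}+bX_{i,j-1}+cX_{i-1,j-1}+\epsilon_{i,j}. \] Let $\gamma_X(h_1,h_2)=\operatorname{cov}(X_{i,j},X_{i-h_1,j-h_2})$ be the autocovariance function of $X$, and put \[ D=(1-a-b-c)(1-a+b+c)(1+a-b+c)(1+a+b-c), \] \[ \alpha=\frac{2(a+bc)}{1+a^2-b^2-c^2+\sqrt D},\qquad \beta=\frac{2(ac+b)}{1-a^2+b^2-c^2+\sqrt D}. \] Then for all $h_1,h_2\in\mathbb Z$ with $h_1h_2\le 0$,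 \[ \gamma_X(h_1,h_2)=\frac{\alpha^{|h_1|}\,\beta^{|h_2|}\,\sigma^2}{\sqrt D} \] (with the convention $0^0=1$). Consequently, $\gamma_X(1,-1)\,\gamma_X(0,0)=\gamma_X(1,0)\,\gamma_X(0,1)$. -/

import Mathlib

open MeasureTheory ProbabilityTheory

/-- Real white noise on the lattice `ℤ × ℤ` with variance `σ ^ 2`: square-integrable, zero-mean,
pairwise uncorrelated random variables, all of variance `σ ^ 2`. -/
structure IsWhiteNoise {Ω : Type*} [MeasurableSpace Ω] (P : Measure Ω) (σ : ℝ)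
    (ε : ℤ → ℤ → Ω → ℝ) : Prop where
  memLp : ∀ i j, MemLp (ε i j) 2 P
  mean_zero : ∀ i j, ∫ ω, ε i j ω ∂P = 0
  second_moment : ∀ i j, ∫ ω, (ε i j ω) ^ 2 ∂P = σ ^ 2
  uncorrelated : ∀ i j k l, (i, j) ≠ (k, l) → covariance (ε i j) (ε k l) P = 0

/-- Wide-sense stationarity of a real random field on `ℤ × ℤ`: finite second moments, constant mean
and translation-invariant covariances. -/
structure IsWideSenseStationary {Ω : Type*} [MeasurableSpace Ω] (P : Measure Ω)
    (X : ℤ → ℤ → Ω → ℝ) : Prop where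
  memLp : ∀ i j, MemLp (X i j) 2 P
  mean_const : ∀ i j k l, ∫ ω, X i j ω ∂P = ∫ ω, X k l ω ∂P
  cov_shift : ∀ i j k l s t,
    covariance (X (i + s) (j + t)) (X (k + s) (l + t)) P = covariance (X i j) (X k l) P

/-- `X i j = a * X (i-1) j + b * X i (j-1) + c * X (i-1) (j-1) + ε i j` almost surely,
at every lattice point. -/
def SatisfiesAR {Ω : Type*} [MeasurableSpace Ω] (P : Measure Ω) (a b c : ℝ)
    (X ε : ℤ → ℤ → Ω → ℝ) : Prop :=
  ∀ i j, ∀ᵐ ω ∂P,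
    X i j ω = a * X (i - 1) j ω + b * X i (j - 1) ω + c * X (i - 1) (j - 1) ω + ε i j ω

/-- The autocovariance function `γ (h₁, h₂) = cov (X i j, X (i - h₁) (j - h₂))` of a wide-sense
stationary field, evaluated at `i = j = 0`; see `IsWideSenseStationary.cov_eq_autocov`. -/
noncomputable def autocov {Ω : Type*} [MeasurableSpace Ω] (P : Measure Ω)
    (X : ℤ → ℤ → Ω → ℝ) (h₁ h₂ : ℤ) : ℝ :=
  covariance (X 0 0) (X (-h₁) (-h₂)) P

/-- For a stationary field the base point in the definition of `autocov` does not matter. -/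
theorem IsWideSenseStationary.cov_eq_autocov {Ω : Type*} [MeasurableSpace Ω] {P : Measure Ω}
    {X : ℤ → ℤ → Ω → ℝ} (hX : IsWideSenseStationary P X) (i j h₁ h₂ : ℤ) :
    covariance (X i j) (X (i - h₁) (j - h₂)) P = autocov P X h₁ h₂ := by
  have h := hX.cov_shift 0 0 (-h₁) (-h₂) i j
  rw [zero_add, zero_add, neg_add_eq_sub, neg_add_eq_sub] at h
  exact h

/-- `D = (1 - a - b - c) (1 - a + b + c) (1 + a - b + c) (1 + a + b - c)`. -/
def arD (a b c : ℝ) : ℝ :=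
  (1 - a - b - c) * (1 - a + b + c) * (1 + a - b + c) * (1 + a + b - c)

noncomputable def arAlpha (a b c : ℝ) : ℝ :=
  2 * (a + b * c) / (1 + a ^ 2 - b ^ 2 - c ^ 2 + Real.sqrt (arD a b c))

noncomputable def arBeta (a b c : ℝ) : ℝ :=
  2 * (a * c + b) / (1 - a ^ 2 + b ^ 2 - c ^ 2 + Real.sqrt (arD a b c))

/-! Let q(h,k) = cov(ε_{i,j}, X_{i-h,j-k}). Pairing the recursion with X expresses q through γ;
pairing it with ε gives q a backward recursion with source σ² at the origin. No causality is
assumed: it is derived. By Bessel the rows of q are uniformly square-summable, and |a + c e^{iθ}|² ≤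
ρ |1 - b e^{iθ}|² with ρ < 1 forces the rows h ≥ 1 to vanish (`rows_eq_zero`). Evenness of γ then
reduces row 0 to a second-order recurrence whose bounded solution is β^|k| σ²/√D. For h ≥ 1, γ
satisfies the homogeneous recursion, which α^m β^n solves at (m,-n) by `arAlpha_eq`; boundedness and
|b| < 1 give uniqueness row by row. -/

/-- A bounded-above sequence with `f n ≤ ρ * f (n + 1)` for some `0 ≤ ρ < 1` is nonpositive. -/
theorem nonpos_of_le_mul_succ {f : ℕ → ℝ} {ρ M : ℝ} (h0 : 0 ≤ ρ) (h1 : ρ < 1)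
    (hM : ∀ n, f n ≤ M) (h : ∀ n, f n ≤ ρ * f (n + 1)) (n : ℕ) : f n ≤ 0 := by
  have key : ∀ k n, f n ≤ ρ ^ k * M := by
    intro k
    induction k with
    | zero => intro n; simpa using hM n
    | succ k ih =>
      intro n
      calc f n ≤ ρ * f (n + 1) := h n
        _ ≤ ρ * (ρ ^ k * M) := mul_le_mul_of_nonneg_left (ih _) h0
        _ = ρ ^ (k + 1) * M := by ring
  have hl : Filter.Tendsto (fun k : ℕ => ρ ^ k * M) Filter.atTop (nhds (0 * M)) :=
    (tendsto_pow_atTop_nhds_zero_of_lt_one h0 h1).mul_const M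
  rw [zero_mul] at hl
  exact ge_of_tendsto' hl fun k => key k n

/-- The only bounded solution of `e n = r * e (n + 1)` with `|r| < 1` is zero. -/
theorem eq_zero_of_eq_mul_succ {e : ℕ → ℝ} {r M : ℝ} (hr : |r| < 1)
    (hM : ∀ n, |e n| ≤ M) (h : ∀ n, e n = r * e (n + 1)) (n : ℕ) : e n = 0 := by
  refine abs_nonpos_iff.1 (nonpos_of_le_mul_succ (f := fun n => |e n|) (abs_nonneg r) hr hM ?_ n)
  intro n
  rw [← abs_mul, ← h n]

/-! ### Square-summable sequences and the shift -/

theorem summable_mul_shift {p : ℤ → ℝ} (hp : Summable fun l => p l ^ 2) :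
    Summable fun l => p l * p (l + 1) := by
  have hs : Summable fun l => p (l + 1) ^ 2 :=
    (Equiv.addRight (1 : ℤ)).summable_iff.2 hp
  refine Summable.of_norm_bounded (hp.add hs) fun l => ?_
  rw [Real.norm_eq_abs, abs_le]
  constructor <;> nlinarith [sq_nonneg (p l + p (l + 1)), sq_nonneg (p l - p (l + 1)),
    sq_nonneg (p l), sq_nonneg (p (l + 1))]

theorem hasSum_sq_add_shift {p : ℤ → ℝ} (hp : Summable fun l => p l ^ 2) (x y : ℝ) :
    HasSum (fun l => (x * p l + y * p (l + 1)) ^ 2)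
      ((x ^ 2 + y ^ 2) * ∑' l, p l ^ 2 + 2 * x * y * ∑' l, p l * p (l + 1)) := by
  have hs : HasSum (fun l => p (l + 1) ^ 2) (∑' l, p l ^ 2) :=
    (Equiv.addRight (1 : ℤ)).hasSum_iff.2 hp.hasSum
  have := ((hp.hasSum.mul_left (x ^ 2)).add (hs.mul_left (y ^ 2))).add
    ((summable_mul_shift hp).hasSum.mul_left (2 * x * y))
  have e : (fun l => (x * p l + y * p (l + 1)) ^ 2)
      = fun l => x ^ 2 * p l ^ 2 + y ^ 2 * p (l + 1) ^ 2 + 2 * x * y * (p l * p (l + 1)) := by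
    funext l
    ring
  rw [e, add_mul]
  exact this

theorem abs_tsum_mul_shift_le {p : ℤ → ℝ} (hp : Summable fun l => p l ^ 2) :
    |∑' l, p l * p (l + 1)| ≤ ∑' l, p l ^ 2 := by
  have h1 := (hasSum_sq_add_shift hp 1 1).nonneg fun l => sq_nonneg _
  have h2 := (hasSum_sq_add_shift hp 1 (-1)).nonneg fun l => sq_nonneg _
  rw [abs_le]
  constructor <;> linarith

/-- If `|a + c| < 1 - b` and `|a - c| < 1 + b`, the quadratic form of `a + c S` is dominated by a
multiple `ρ < 1` of that of `1 - b S`, where `S` is the shift. -/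
theorem exists_contraction {a b c : ℝ}
    (hf₁ : 0 < 1 - a - b - c) (hf₂ : 0 < 1 - a + b + c)
    (hf₃ : 0 < 1 + a - b + c) (hf₄ : 0 < 1 + a + b - c) :
    ∃ ρ : ℝ, 0 ≤ ρ ∧ ρ < 1 ∧ ∀ N R : ℝ, |R| ≤ N →
      (a ^ 2 + c ^ 2) * N + 2 * a * c * R ≤ ρ * ((1 + b ^ 2) * N - 2 * b * R) := by
  have hb1 : 0 < 1 - b := by linarith
  have hb2 : 0 < 1 + b := by linarith
  have hu : (a + c) ^ 2 / (1 - b) ^ 2 < 1 := by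
    rw [div_lt_one (by positivity)]
    exact sq_lt_sq' (by linarith) (by linarith)
  have hv : (a - c) ^ 2 / (1 + b) ^ 2 < 1 := by
    rw [div_lt_one (by positivity)]
    exact sq_lt_sq' (by linarith) (by linarith)
  -- Both sides are linear in (N, R), so the extreme rays R = N and R = -N of the cone |R| ≤ N
  -- suffice; each contributes one ratio.
  refine ⟨max ((a + c) ^ 2 / (1 - b) ^ 2) ((a - c) ^ 2 / (1 + b) ^ 2),
    le_max_of_le_left (by positivity), max_lt hu hv, ?_⟩
  set ρ := max ((a + c) ^ 2 / (1 - b) ^ 2) ((a - c) ^ 2 / (1 + b) ^ 2)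
  intro N R hR
  have h1 : (a + c) ^ 2 ≤ ρ * (1 - b) ^ 2 :=
    (div_le_iff₀ (by positivity)).1 (le_max_left _ _)
  have h2 : (a - c) ^ 2 ≤ ρ * (1 + b) ^ 2 :=
    (div_le_iff₀ (by positivity)).1 (le_max_right _ _)
  obtain ⟨h3, h4⟩ := abs_le.1 hR
  linarith [mul_le_mul_of_nonneg_right h1 (by linarith : 0 ≤ N + R),
    mul_le_mul_of_nonneg_right h2 (by linarith : 0 ≤ N - R)]

/-- Uniformly square-summable rows satisfying `(1 - b S) p k = (a + c S) p (k + 1)` vanish. -/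
theorem rows_eq_zero {a b c : ℝ}
    (hf₁ : 0 < 1 - a - b - c) (hf₂ : 0 < 1 - a + b + c)
    (hf₃ : 0 < 1 + a - b + c) (hf₄ : 0 < 1 + a + b - c)
    {p : ℕ → ℤ → ℝ} {M : ℝ} (hM : ∀ k (s : Finset ℤ), ∑ l ∈ s, p k l ^ 2 ≤ M)
    (hp : ∀ k l, p k l - b * p k (l + 1) = a * p (k + 1) l + c * p (k + 1) (l + 1))
    (k : ℕ) (l : ℤ) : p k l = 0 := by
  have hs : ∀ k, Summable fun l => p k l ^ 2 := fun k =>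
    summable_of_sum_le (fun l => sq_nonneg _) (hM k)
  have hN : ∀ k, ∑' l, p k l ^ 2 ≤ M := fun k => (hs k).tsum_le_of_sum_le (hM k)
  have hN0 : ∀ k, 0 ≤ ∑' l, p k l ^ 2 := fun k => tsum_nonneg fun l => sq_nonneg _
  have hR : ∀ k, |∑' l, p k l * p k (l + 1)| ≤ ∑' l, p k l ^ 2 := fun k =>
    abs_tsum_mul_shift_le (hs k)
  obtain ⟨ρ, h0, h1, hρ⟩ := exists_contraction hf₁ hf₂ hf₃ hf₄
  have hb : |b| < 1 := abs_lt.2 ⟨by linarith, by linarith⟩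
  have hbR : ∀ k, |b * ∑' l, p k l * p k (l + 1)| ≤ |b| * ∑' l, p k l ^ 2 := fun k => by
    rw [abs_mul]
    exact mul_le_mul_of_nonneg_left (hR k) (abs_nonneg b)
  -- E k is the squared norm of (1 - b S) p k, hence also of (a + c S) p (k + 1).
  let E : ℕ → ℝ := fun k => (1 + b ^ 2) * ∑' l, p k l ^ 2 - 2 * b * ∑' l, p k l * p k (l + 1)
  have hE : ∀ k, E k = (a ^ 2 + c ^ 2) * ∑' l, p (k + 1) l ^ 2
      + 2 * a * c * ∑' l, p (k + 1) l * p (k + 1) (l + 1) := fun k => by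
    have e1 := hasSum_sq_add_shift (hs k) 1 (-b)
    have e2 := hasSum_sq_add_shift (hs (k + 1)) a c
    have e3 : (fun l => (1 * p k l + -b * p k (l + 1)) ^ 2)
        = fun l => (a * p (k + 1) l + c * p (k + 1) (l + 1)) ^ 2 := by
      ext l
      rw [← hp k l]
      ring
    rw [e3] at e1
    rw [← e1.unique e2]
    simp only [E]
    ring
  have hE1 : ∀ k, E k ≤ ρ * E (k + 1) := fun k => by
    rw [hE k]
    exact hρ _ _ (hR (k + 1))
  have hE2 : ∀ k, E k ≤ 4 * M := fun k => by
    have h2 := (abs_le.1 (hbR k)).1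
    have h3 : |b| * ∑' l, p k l ^ 2 ≤ 1 * ∑' l, p k l ^ 2 :=
      mul_le_mul_of_nonneg_right hb.le (hN0 k)
    have h4 : b ^ 2 * ∑' l, p k l ^ 2 ≤ 1 * ∑' l, p k l ^ 2 :=
      mul_le_mul_of_nonneg_right ((sq_lt_one_iff_abs_lt_one b).2 hb).le (hN0 k)
    have h5 := hN k
    simp only [E]
    linarith
  have hE3 : E k ≤ 0 := nonpos_of_le_mul_succ h0 h1 hE2 hE1 k
  have h2 := (abs_le.1 (hbR k)).2
  -- Since |b| < 1, 1 - b S is bounded below, so E k ≤ 0 kills the row itself.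
  have h3 : (1 - |b|) ^ 2 * ∑' l, p k l ^ 2 ≤ 0 := by
    have : (1 - |b|) ^ 2 = 1 - 2 * |b| + b ^ 2 := by rw [← sq_abs b]; ring
    rw [this]
    simp only [E] at hE3
    linarith
  have h4 : 0 < (1 - |b|) ^ 2 := by
    have : 0 < 1 - |b| := by linarith
    positivity
  have h5 : ∑' l, p k l ^ 2 ≤ 0 := nonpos_of_mul_nonpos_right h3 h4
  have h6 : p k l ^ 2 ≤ ∑' l, p k l ^ 2 := (hs k).le_tsum l fun j _ => sq_nonneg _
  exact pow_eq_zero_iff two_ne_zero |>.1 (le_antisymm (h6.trans h5) (sq_nonneg _))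

/-! ### Solving the Yule-Walker equations -/

/-- Bounded even solutions of `A v h - B (v (h - 1) + v (h + 1)) = s δ` decay geometrically. -/
theorem bounded_solution_second_order {A B d s M : ℝ} (hAB : 2 * |B| < A) (hd : 0 < d)
    (hdD : d ^ 2 = A ^ 2 - 4 * B ^ 2) {v : ℕ → ℝ} (hM : ∀ n, |v n| ≤ M)
    (h0 : A * v 0 - 2 * B * v 1 = s)
    (h : ∀ n, A * v (n + 1) - B * (v n + v (n + 2)) = 0) (n : ℕ) :
    v n = (2 * B / (A + d)) ^ n * (s / d) := by
  have hA : 0 < A := lt_of_le_of_lt (by positivity) hAB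
  set β := 2 * B / (A + d) with hβ
  have hAd : 0 < A + d := by positivity
  have hβB : (A + d) * β = 2 * B := by rw [hβ]; field_simp
  have hβ1 : |β| < 1 := by
    rw [hβ, abs_div, abs_of_pos hAd, div_lt_one hAd, abs_mul, abs_two]
    linarith
  have hBβ : 2 * B * β = A - d := by
    have : (A + d) * (2 * B * β) = (A + d) * (A - d) := by
      linear_combination 2 * B * hβB + hdD
    exact mul_left_cancel₀ hAd.ne' this
  -- β is the root of B x² - A x + B in (-1, 1), in a form valid for B = 0. Factoring out this root
  -- leaves a first-order recursion for v (n + 1) - β v n whose nonzero solutions are unbounded.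
  have hz : ∀ n, v (n + 1) - β * v n = 0 := by
    refine eq_zero_of_eq_mul_succ (e := fun n => v (n + 1) - β * v n) (r := β) (M := 2 * M)
      hβ1 (fun n => ?_) (fun n => ?_)
    · have h1 : |β * v n| ≤ M := by
        rw [abs_mul]
        calc |β| * |v n| ≤ 1 * |v n| := mul_le_mul_of_nonneg_right hβ1.le (abs_nonneg _)
          _ ≤ M := by rw [one_mul]; exact hM n
      calc |v (n + 1) - β * v n| ≤ |v (n + 1)| + |β * v n| := abs_sub _ _
        _ ≤ 2 * M := by linarith [hM (n + 1)]
    · refine mul_left_cancel₀ hAd.ne' ?_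
      show (A + d) * (v (n + 1) - β * v n) = (A + d) * (β * (v (n + 2) - β * v (n + 1)))
      linear_combination 2 * h n - (v n + v (n + 2)) * hβB + v (n + 1) * hBβ
        + β * v (n + 1) * hβB
  have hv : ∀ n, v n = β ^ n * v 0 := by
    intro n
    induction n with
    | zero => simp
    | succ n ih => rw [pow_succ, sub_eq_zero.1 (hz n), ih]; ring
  have hv0 : v 0 = s / d := by
    rw [eq_div_iff hd.ne']
    linear_combination h0 + 2 * B * hz 0 + v 0 * hBβ
  rw [hv n, hv0]

theorem arD_eq_beta (a b c : ℝ) :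
    arD a b c = (1 - a ^ 2 + b ^ 2 - c ^ 2) ^ 2 - 4 * (a * c + b) ^ 2 := by
  unfold arD; ring

/-- Compatibility of α and β with the homogeneous recursion; after clearing denominators it is (√D)²
= D. -/
theorem arAlpha_eq {a b c : ℝ}
    (hf₁ : 0 < 1 - a - b - c) (hf₂ : 0 < 1 - a + b + c)
    (hf₃ : 0 < 1 + a - b + c) (hf₄ : 0 < 1 + a + b - c) :
    arAlpha a b c = b * (arAlpha a b c * arBeta a b c) + a + c * arBeta a b c := by
  have hD : 0 ≤ arD a b c := by unfold arD; positivity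
  have hd := Real.sq_sqrt hD
  have h0 := Real.sqrt_nonneg (arD a b c)
  have hA : 0 < 1 + a ^ 2 - b ^ 2 - c ^ 2 + √(arD a b c) := by
    linarith [mul_pos hf₁ hf₂, mul_pos hf₃ hf₄]
  have hB : 0 < 1 - a ^ 2 + b ^ 2 - c ^ 2 + √(arD a b c) := by
    linarith [mul_pos hf₁ hf₃, mul_pos hf₂ hf₄]
  rw [arD_eq_beta] at hd
  unfold arAlpha arBeta
  rw [arD_eq_beta] at *
  set d := √((1 - a ^ 2 + b ^ 2 - c ^ 2) ^ 2 - 4 * (a * c + b) ^ 2)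
  field_simp
  linear_combination -a * hd

/-- The deterministic core: bounded even solutions `γ` of the Yule-Walker equations. -/
theorem yule_walker_solution {a b c s M M' : ℝ}
    (hf₁ : 0 < 1 - a - b - c) (hf₂ : 0 < 1 - a + b + c)
    (hf₃ : 0 < 1 + a - b + c) (hf₄ : 0 < 1 + a + b - c)
    {γ q : ℤ → ℤ → ℝ} (hsymm : ∀ h k, γ (-h) (-k) = γ h k) (hM : ∀ h k, |γ h k| ≤ M)
    (hq : ∀ h k, q h k = γ h k - a * γ (h - 1) k - b * γ h (k - 1) - c * γ (h - 1) (k - 1))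
    (hqM : ∀ h (t : Finset ℤ), ∑ k ∈ t, q h k ^ 2 ≤ M')
    (hq' : ∀ h k, q h k - a * q (h + 1) k - b * q h (k + 1) - c * q (h + 1) (k + 1)
      = if h = 0 ∧ k = 0 then s else 0) (m n : ℕ) :
    γ m (-n) = arAlpha a b c ^ m * arBeta a b c ^ n * s / √(arD a b c) := by
  have hq0 : ∀ (m : ℕ) (k : ℤ), q (m + 1) k = 0 := by
    refine rows_eq_zero (p := fun m k => q (m + 1) k) hf₁ hf₂ hf₃ hf₄
      (fun k => hqM (k + 1)) fun m k => ?_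
    have h1 := hq' (m + 1) k
    rw [if_neg (by rintro ⟨h, -⟩; omega)] at h1
    push_cast
    linarith
  have hb : |b| < 1 := abs_lt.2 ⟨by linarith, by linarith⟩
  have hDpos : 0 < arD a b c := by unfold arD; positivity
  have hax : ∀ n : ℕ, γ 0 n = arBeta a b c ^ n * (s / √(arD a b c)) := by
    -- Expand q 0 k - b q 0 (k + 1) in γ, reflect row -1 to row 1, and eliminate row 1 using q 1
    -- (-k) = q 1 (-k + 1) = 0.
    have eqn : ∀ k : ℤ, (1 - a ^ 2 + b ^ 2 - c ^ 2) * γ 0 k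
        - (a * c + b) * (γ 0 (k - 1) + γ 0 (k + 1)) = if k = 0 then s else 0 := by
      intro k
      have e0 := hq' 0 k
      have z1 := hq0 0 k
      have z2 := hq0 0 (k + 1)
      have z3 := hq0 0 (-k)
      have z4 := hq0 0 (-k + 1)
      simp only [Nat.cast_zero, zero_add, true_and] at e0 z1 z2 z3 z4
      have s1 : γ (-1) k = γ 1 (-k) := by simpa using hsymm 1 (-k)
      have s2 : γ (-1) (k - 1) = γ 1 (-k + 1) := by
        rw [← hsymm 1 (-k + 1)]; congr 1; ring
      have s3 : γ (-1) (k + 1) = γ 1 (-k - 1) := by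
        rw [← hsymm 1 (-k - 1)]; congr 1; ring
      have s4 : γ 0 (-k) = γ 0 k := by simpa using hsymm 0 k
      have s5 : γ 0 (-k - 1) = γ 0 (k + 1) := by
        rw [← hsymm 0 (k + 1), neg_zero]; congr 1; ring
      have s6 : γ 0 (-k + 1) = γ 0 (k - 1) := by
        rw [← hsymm 0 (k - 1), neg_zero]; congr 1; ring
      rw [z1, z2, hq, hq, zero_sub, add_sub_cancel_right, s1, s2, s3] at e0
      rw [hq, sub_self, s4, s5] at z3
      rw [hq, sub_self, add_sub_cancel_right, s4, s6] at z4
      linear_combination e0 + a * z3 + c * z4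
    intro n
    unfold arBeta
    refine bounded_solution_second_order (v := fun n : ℕ => γ 0 n) (M := M)
      ?_ (Real.sqrt_pos.2 hDpos) ?_ (fun n => hM _ _) ?_ (fun n => ?_) n
    · rw [← abs_two, ← abs_mul, abs_lt]
      constructor
      · linarith [mul_pos hf₂ hf₄]
      · linarith [mul_pos hf₁ hf₃]
    · rw [Real.sq_sqrt hDpos.le, arD_eq_beta]
    · have h1 := eqn 0
      have h2 := hsymm 0 1
      simp only [neg_zero, zero_sub, zero_add, if_true] at h1 h2
      push_cast
      rw [h2] at h1
      linarith
    · have h1 := eqn (n + 1)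
      rw [if_neg (by omega), add_sub_cancel_right, add_assoc] at h1
      push_cast
      exact h1
  induction m generalizing n with
  | zero =>
    have h1 := hsymm 0 n
    rw [neg_zero] at h1
    rw [Nat.cast_zero, h1, hax]
    ring
  | succ m ih =>
    -- With row m known, the error in row m + 1 satisfies e n = b e (n + 1).
    refine sub_eq_zero.1 (eq_zero_of_eq_mul_succ (r := b)
      (M := M + |arAlpha a b c| * M)
      (e := fun n : ℕ => γ (m + 1 : ℕ) (-n)
        - arAlpha a b c ^ (m + 1) * arBeta a b c ^ n * s / √(arD a b c)) hb ?_ ?_ n)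
    · intro n
      have h1 : arAlpha a b c ^ (m + 1) * arBeta a b c ^ n * s / √(arD a b c)
          = arAlpha a b c * γ m (-n) := by rw [ih]; ring
      rw [h1]
      calc _ ≤ |γ (m + 1 : ℕ) (-n)| + |arAlpha a b c * γ m (-n)| := abs_sub _ _
        _ ≤ _ := by
          rw [abs_mul]
          exact add_le_add (hM _ _) (mul_le_mul_of_nonneg_left (hM _ _) (abs_nonneg _))
    · intro n
      have z := hq0 m (-n)
      rw [hq, add_sub_cancel_right] at z
      have i1 := ih n
      have i2 := ih (n + 1)
      have e : (-(n : ℤ) - 1) = -((n + 1 : ℕ) : ℤ) := by push_cast; ring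
      rw [e, i1, i2] at z
      have := arAlpha_eq hf₁ hf₂ hf₃ hf₄
      have hc : ((m + 1 : ℕ) : ℤ) = (m : ℤ) + 1 := by push_cast; ring
      simp only [hc]
      linear_combination z
        - arAlpha a b c ^ m * arBeta a b c ^ n * s / √(arD a b c) * this

/-! ### Covariances of the field and the noise -/

/-- Bessel's inequality for a pairwise uncorrelated family of common variance. -/
theorem sum_sq_covariance_le {Ω ι : Type*} [MeasurableSpace Ω] [DecidableEq ι] {P : Measure Ω}
    [IsProbabilityMeasure P] {e : ι → Ω → ℝ} {Y : Ω → ℝ} {s : ℝ} (hs : 0 < s)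
    (he : ∀ i, MemLp (e i) 2 P) (hY : MemLp Y 2 P)
    (hcov : ∀ i j, covariance (e i) (e j) P = if i = j then s else 0) (t : Finset ι) :
    ∑ i ∈ t, covariance (e i) Y P ^ 2 ≤ s * variance Y P := by
  set κ : ι → ℝ := fun i => covariance (e i) Y P with hκ
  let Z : Ω → ℝ := fun ω => ∑ i ∈ t, κ i * e i ω
  have hke : ∀ i ∈ t, MemLp (fun ω => κ i * e i ω) 2 P := fun i _ => (he i).const_mul _
  have hZ : MemLp Z 2 P := memLp_finsetSum t hke
  have h1 : covariance Z Y P = ∑ i ∈ t, κ i ^ 2 := by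
    rw [covariance_fun_sum_left' hke hY]
    refine Finset.sum_congr rfl fun i _ => ?_
    rw [covariance_const_mul_left, sq]
  have h2 : ∀ i ∈ t, covariance Z (e i) P = s * κ i := fun i hi => by
    rw [covariance_fun_sum_left' hke (he i)]
    simp only [covariance_const_mul_left, hcov]
    simp [hi, mul_comm]
  have h3 : variance Z P = s * ∑ i ∈ t, κ i ^ 2 := by
    rw [← covariance_self hZ.aemeasurable, covariance_fun_sum_right' hke hZ, Finset.mul_sum]
    refine Finset.sum_congr rfl fun i hi => ?_
    rw [covariance_const_mul_right, h2 i hi]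
    ring
  -- Z / s is the projection of Y onto the family, up to constants; scaling by s avoids division.
  have h4 : 0 ≤ variance (Z - fun ω => s * Y ω) P := variance_nonneg _ _
  rw [variance_sub hZ (hY.const_mul s), variance_const_mul, covariance_const_mul_right, h1, h3]
    at h4
  have h5 : 0 ≤ s * (s * variance Y P - ∑ i ∈ t, κ i ^ 2) := by linarith
  linarith [nonneg_of_mul_nonneg_right h5 hs]

theorem IsWideSenseStationary.cov_eq {Ω : Type*} [MeasurableSpace Ω] {P : Measure Ω}
    {X : ℤ → ℤ → Ω → ℝ} (hX : IsWideSenseStationary P X) (i j k l : ℤ) :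
    covariance (X i j) (X k l) P = autocov P X (i - k) (j - l) := by
  rw [← hX.cov_eq_autocov i j, sub_sub_cancel, sub_sub_cancel]

theorem IsWideSenseStationary.autocov_neg {Ω : Type*} [MeasurableSpace Ω] {P : Measure Ω}
    {X : ℤ → ℤ → Ω → ℝ} (hX : IsWideSenseStationary P X) (h k : ℤ) :
    autocov P X (-h) (-k) = autocov P X h k := by
  unfold autocov
  rw [covariance_comm, hX.cov_eq, hX.cov_eq]
  congr 1 <;> ring

theorem abs_autocov_le {Ω : Type*} [MeasurableSpace Ω] {P : Measure Ω} [IsProbabilityMeasure P]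
    {X : ℤ → ℤ → Ω → ℝ} (hX : IsWideSenseStationary P X) (h k : ℤ) :
    |autocov P X h k| ≤ autocov P X 0 0 := by
  have hm := hX.memLp 0 0
  have hm' := hX.memLp (-h) (-k)
  have v1 : variance (X 0 0) P = autocov P X 0 0 := by
    rw [← covariance_self hm.aemeasurable, hX.cov_eq, sub_zero]
  have v2 : variance (X (-h) (-k)) P = autocov P X 0 0 := by
    rw [← covariance_self hm'.aemeasurable, hX.cov_eq, sub_self, sub_self]
  have h1 := variance_nonneg (X 0 0 + X (-h) (-k)) P
  have h2 := variance_nonneg (X 0 0 - X (-h) (-k)) P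
  rw [variance_add hm hm', v1, v2] at h1
  rw [variance_sub hm hm', v1, v2] at h2
  change |covariance (X 0 0) (X (-h) (-k)) P| ≤ _
  rw [abs_le]
  constructor <;> linarith

theorem covariance_congr_ae_left {Ω : Type*} [MeasurableSpace Ω] {P : Measure Ω}
    {U V Y : Ω → ℝ} (h : U =ᵐ[P] V) : covariance U Y P = covariance V Y P := by
  unfold covariance
  rw [integral_congr_ae h]
  refine integral_congr_ae ?_
  filter_upwards [h] with ω hω
  rw [hω]

/-- The innovation as a linear combination of field values, paired with a random variable. -/
theorem SatisfiesAR.covariance_noise {Ω : Type*} [MeasurableSpace Ω] {P : Measure Ω}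
    [IsProbabilityMeasure P] {a b c : ℝ} {X ε : ℤ → ℤ → Ω → ℝ}
    (hAR : SatisfiesAR P a b c X ε) (hX : ∀ i j, MemLp (X i j) 2 P) {Y : Ω → ℝ}
    (hY : MemLp Y 2 P) (i j : ℤ) :
    covariance (ε i j) Y P = covariance (X i j) Y P - a * covariance (X (i - 1) j) Y P
      - b * covariance (X i (j - 1)) Y P - c * covariance (X (i - 1) (j - 1)) Y P := by
  have e : ε i j =ᵐ[P] X i j - a • X (i - 1) j - b • X i (j - 1) - c • X (i - 1) (j - 1) := by
    filter_upwards [hAR i j] with ω hω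
    simp only [Pi.sub_apply, Pi.smul_apply, smul_eq_mul]
    linarith
  have hc := covariance_congr_ae_left (Y := Y) e
  have m1 := hX i j
  have m2 := (hX (i - 1) j).const_smul a
  have m3 := (hX i (j - 1)).const_smul b
  have m4 := (hX (i - 1) (j - 1)).const_smul c
  rw [hc, covariance_sub_left ((m1.sub m2).sub m3) m4 hY,
    covariance_sub_left (m1.sub m2) m3 hY, covariance_sub_left m1 m2 hY,
    covariance_smul_left, covariance_smul_left, covariance_smul_left]

theorem IsWhiteNoise.cov_eq {Ω : Type*} [MeasurableSpace Ω] {P : Measure Ω}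
    [IsProbabilityMeasure P] {σ : ℝ} {ε : ℤ → ℤ → Ω → ℝ} (hε : IsWhiteNoise P σ ε)
    (i j k l : ℤ) :
    covariance (ε i j) (ε k l) P = if i = k ∧ j = l then σ ^ 2 else 0 := by
  split_ifs with h
  · obtain ⟨rfl, rfl⟩ := h
    rw [covariance_self (hε.memLp i j).aemeasurable,
      variance_of_integral_eq_zero (hε.memLp i j).aemeasurable (hε.mean_zero i j)]
    exact hε.second_moment i j
  · exact hε.uncorrelated i j k l fun e => h (Prod.mk.inj e)

theorem autocov_nat_neg_nat {Ω : Type*} [MeasurableSpace Ω] {P : Measure Ω}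
    [IsProbabilityMeasure P] {a b c σ : ℝ} (hσ : 0 < σ)
    (hf₁ : 0 < 1 - a - b - c) (hf₂ : 0 < 1 - a + b + c)
    (hf₃ : 0 < 1 + a - b + c) (hf₄ : 0 < 1 + a + b - c)
    {X ε : ℤ → ℤ → Ω → ℝ} (hε : IsWhiteNoise P σ ε) (hX : IsWideSenseStationary P X)
    (hAR : SatisfiesAR P a b c X ε) (m n : ℕ) :
    autocov P X m (-n) =
      arAlpha a b c ^ m * arBeta a b c ^ n * σ ^ 2 / √(arD a b c) := by
  set q : ℤ → ℤ → ℝ := fun h k => autocov P X h k - a * autocov P X (h - 1) k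
    - b * autocov P X h (k - 1) - c * autocov P X (h - 1) (k - 1) with hq
  have hεX : ∀ i j k l, covariance (ε i j) (X k l) P = q (i - k) (j - l) := fun i j k l => by
    rw [hAR.covariance_noise hX.memLp (hX.memLp k l), hX.cov_eq, hX.cov_eq, hX.cov_eq, hX.cov_eq,
      sub_right_comm i 1 k, sub_right_comm j 1 l]
  refine yule_walker_solution (M := autocov P X 0 0)
    (M' := σ ^ 2 * variance (X 0 0) P) hf₁ hf₂ hf₃ hf₄ hX.autocov_neg
    (abs_autocov_le hX) (q := q) (fun h k => rfl) (fun h t => ?_) (fun h k => ?_) m n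
  · have := sum_sq_covariance_le (e := fun k => ε h k) (pow_pos hσ 2) (fun k => hε.memLp h k)
      (hX.memLp 0 0) (fun k l => by simp [hε.cov_eq]) t
    simpa [hεX] using this
  -- Expanding the second noise at (-h, -k) turns its backward lattice steps into forward steps of
  -- q.
  · have h1 := hε.cov_eq 0 0 (-h) (-k)
    rw [covariance_comm, hAR.covariance_noise hX.memLp (hε.memLp 0 0)] at h1
    simp only [covariance_comm (X _ _), hεX] at h1
    rw [show (0 : ℤ) - -h = h by ring, show (0 : ℤ) - -k = k by ring,
      show (0 : ℤ) - (-h - 1) = h + 1 by ring, show (0 : ℤ) - (-k - 1) = k + 1 by ring] at h1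
    rw [h1]
    simp only [zero_eq_neg]

theorem mainTheorem7 {Ω : Type*} [MeasurableSpace Ω] (P : Measure Ω) [IsProbabilityMeasure P]
    (a b c σ : ℝ) (hσ : 0 < σ)
    (hf₁ : 0 < 1 - a - b - c) (hf₂ : 0 < 1 - a + b + c)
    (hf₃ : 0 < 1 + a - b + c) (hf₄ : 0 < 1 + a + b - c)
    (X ε : ℤ → ℤ → Ω → ℝ)
    (hε : IsWhiteNoise P σ ε) (hX : IsWideSenseStationary P X) (hAR : SatisfiesAR P a b c X ε) :
    (∀ h₁ h₂ : ℤ, h₁ * h₂ ≤ 0 →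
      autocov P X h₁ h₂ =
        arAlpha a b c ^ h₁.natAbs * arBeta a b c ^ h₂.natAbs * σ ^ 2 / Real.sqrt (arD a b c)) ∧
    autocov P X 1 (-1) * autocov P X 0 0 = autocov P X 1 0 * autocov P X 0 1 := by
  have main : ∀ h₁ h₂ : ℤ, h₁ * h₂ ≤ 0 →
      autocov P X h₁ h₂ =
        arAlpha a b c ^ h₁.natAbs * arBeta a b c ^ h₂.natAbs * σ ^ 2 / √(arD a b c) := by
    intro h₁ h₂ h
    have key := autocov_nat_neg_nat hσ hf₁ hf₂ hf₃ hf₄ hε hX hAR h₁.natAbs h₂.natAbs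
    rw [← key]
    rcases mul_nonpos_iff.1 h with ⟨h1, h2⟩ | ⟨h1, h2⟩
    · rw [Int.natAbs_of_nonneg h1, Int.ofNat_natAbs_of_nonpos h2, neg_neg]
    · rw [Int.ofNat_natAbs_of_nonpos h1, Int.natAbs_of_nonneg h2, hX.autocov_neg]
  refine ⟨main, ?_⟩
  rw [main 1 (-1) (by norm_num), main 0 0 (by norm_num), main 1 0 (by norm_num),
    main 0 1 (by norm_num)]
  simp only [Int.natAbs_neg, Int.natAbs_one, Int.natAbs_zero, pow_one, pow_zero]
  ring
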